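/- Let $K$ be a field of characteristic $0$, let $n\ge 1$, let $K[X,Y]=K[x_1,\ldots,x_n,y_1,\ldots,y_n]$, let $\Delta=\sum_{i=1}^n x_i\,\partial/\partial y_i$, and let $K[X,Y]^{\Delta}=\ker\Delta$ be the algebra of constants of $\Delta$. Let $K[X,U]$ be the polynomial algebra in the variables $x_i$ ($1\le i\le n$) and $u_{ij}$ ($1\le i<j\le n$), and let $\pi:K[X,U]\to K[X,Y]$ be the $K$-algebra homomorphism with $\pi(x_i)=x_i$ and $\pi(u_{ij})=x_iy_j-x_jy_i$. Put \[ R=\{u_{ij}u_{kl}-u_{ik}u_{jl}+u_{il}u_{jk}\mid 1\le i<j<k<l\le n\},\qquad S=\{x_iu_{jk}-x_ju_{ik}+x_ku_{ij}\mid 1\le i<j<k\le n\}, \] and let $(R,S)$ be the ideal of $K[X,U]$ generated by $R\cup S$. The degree--interval length--lexicographic (DILL) order on the monomials of $K[X,U]$ is the following admissible order. Write a monomial as $v=x_{i_1}\cdots x_{i_c}u_{j_1k_1}\cdots u_{j_dk_d}$ with $i_1\le\cdots\le i_c$, $j_1\le\cdots\le j_d$, and $k_a\le k_{a+1}$ whenever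 $j_a=j_{a+1}$; its total interval length is $\sum_b (k_b-j_b)$. Then $v\succ v'$ if $v$ has larger degree $c$ in $X$; or the same $c$ and larger degree $d$ in $U$; or the same $c,d$ and larger total interval length; or the same $c,d$ and total interval length, and, at the first position where the tuples $(i_1,\ldots,i_c,j_1,\ldots,j_d,k_1,\ldots,k_d)$ of $v$ and of $v'$ differ, the entry of $v$ is smaller than that of $v'$. A set $G$ of nonzero polynomials that generates an ideal $J$ is a Gröbner basis of $J$ if the leading monomial of each nonzero $f\in J$ is divisible by the leading monomial of some $g\in G$; it is called reduced if, for each $g\in G$, no monomial occurring in $g$ is divisible by the leading monomial of an element of $G\setminus\{g\}$ (leading coefficients are not required to be $1$). (i) The homomorphism $\pi$ induces an isomorphism of $K$-algebras $K[X,U]/(R,S)\cong K[X,Y]^{\Delta}$. (ii) The set $R\cup S$ is the reduced Gröbner basis of the ideal $(R,S)$ with respect to the DILL order. (iii) The images under $\pi$ of the monomials $x_{i_1}\cdots x_{i_c}u_{j_1k_1}\cdots u_{j_dk_d}$ such that no two $u_{j_pk_p}$, $u_{j_qk_q}$ intersect (i.e. neither $j_p<j_q<k_p<k_q$ nor $j_q<j_p<k_q<k_p$)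 and no $u_{j_pk_p}$ covers any $x_{i_t}$ (i.e. never $j_p<i_t<k_p$), taken over pairwise different monomials, form a basis of the vector space $K[X,Y]^{\Delta}$. -/

import Mathlib

namespace Nowicki

open MvPolynomial

/-! ### The Weitzenböck derivation with Jordan cells of size two -/

/-- `K[X,Y]`: the variable `x_i` is `X (Sum.inl i)` and the variable `y_i` is `X (Sum.inr i)`. -/
abbrev PolyXY (n : ℕ) (K : Type*) [CommSemiring K] := MvPolynomial (Fin n ⊕ Fin n) K

/-- The derivation `Δ = ∑ i, x_i ∂/∂y_i` of `K[X,Y]`. -/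
noncomputable def Delta (n : ℕ) (K : Type*) [Field K] :
    Derivation K (PolyXY n K) (PolyXY n K) :=
  ∑ i : Fin n, (X (Sum.inl i) : PolyXY n K) • pderiv (Sum.inr i)

/-- The algebra of constants `K[X,Y]^Δ`, i.e. the kernel of `Δ`. -/
noncomputable def constants (n : ℕ) (K : Type*) [Field K] : Subalgebra K (PolyXY n K) where
  carrier := {f | Delta n K f = 0}
  mul_mem' := by
    intro a b ha hb
    simp only [Set.mem_ofPred_eq] at ha hb ⊢
    simp [Derivation.leibniz, ha, hb]
  add_mem' := by
    intro a b ha hb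
    simp only [Set.mem_ofPred_eq] at ha hb ⊢
    simp [ha, hb]
  algebraMap_mem' := by
    intro r
    simp

/-! ### The polynomial algebra `K[X,U]` -/

/-- The index `(i, j)`, `i < j`, of the variable `u_{ij}`, regarded as the open interval `(i, j)`.
The set of indices is ordered lexicographically (first by `i`, then by `j`). -/
abbrev Interval (n : ℕ) := {p : Fin n ×ₗ Fin n // (ofLex p).1 < (ofLex p).2}

/-- The left end `i` of the interval `(i, j)`. -/
def Interval.left {n : ℕ} (p : Interval n) : Fin n := (ofLex p.1).1

/-- The right end `j` of the interval `(i, j)`. -/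
def Interval.right {n : ℕ} (p : Interval n) : Fin n := (ofLex p.1).2

/-- The interval length `|u_{ij}| = j - i` (a natural number since `i < j`). -/
def Interval.length {n : ℕ} (p : Interval n) : ℕ := (p.right : ℕ) - (p.left : ℕ)

/-- `u_{ij}` and `u_{kl}` intersect each other: `i < k < j < l` or `k < i < l < j`. -/
def Interval.Intersects {n : ℕ} (p q : Interval n) : Prop :=
  (p.left < q.left ∧ q.left < p.right ∧ p.right < q.right) ∨
    (q.left < p.left ∧ p.left < q.right ∧ q.right < p.right)

/-- `u_{ij}` covers `x_k`: `k` lies in the open interval `(i, j)`. -/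
def Interval.Covers {n : ℕ} (p : Interval n) (k : Fin n) : Prop :=
  p.left < k ∧ k < p.right

/-- The variables `X ∪ U`. -/
abbrev Var (n : ℕ) := Fin n ⊕ Interval n

/-- The polynomial algebra `K[X,U]`. -/
abbrev PolyXU (n : ℕ) (K : Type*) [CommSemiring K] := MvPolynomial (Var n) K

/-- The variable `x_i` of `K[X,U]`. -/
noncomputable def x {n : ℕ} (K : Type*) [Field K] (i : Fin n) : PolyXU n K := X (Sum.inl i)

/-- The variable `u_{ij}` of `K[X,U]`. -/
noncomputable def u {n : ℕ} (K : Type*) [Field K] (i j : Fin n) (h : i < j) : PolyXU n K :=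
  X (Sum.inr ⟨toLex (i, j), h⟩)

/-- The homomorphism `K[X,U] → K[X,Y]` with `x_i ↦ x_i` and `u_{ij} ↦ x_i y_j - x_j y_i`. -/
noncomputable def piHom (n : ℕ) (K : Type*) [Field K] : PolyXU n K →ₐ[K] PolyXY n K :=
  aeval (Sum.elim (fun i => X (Sum.inl i))
    (fun p => X (Sum.inl p.left) * X (Sum.inr p.right) - X (Sum.inl p.right) * X (Sum.inr p.left)))

/-- `R`: all `r(i,j,k,l) = u_{ij} u_{kl} - u_{ik} u_{jl} + u_{il} u_{jk}`, `i < j < k < l`. -/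
def relR (n : ℕ) (K : Type*) [Field K] : Set (PolyXU n K) :=
  {f | ∃ (i j k l : Fin n) (hij : i < j) (hjk : j < k) (hkl : k < l),
    f = u K i j hij * u K k l hkl
      - u K i k (hij.trans hjk) * u K j l (hjk.trans hkl)
      + u K i l ((hij.trans hjk).trans hkl) * u K j k hjk}

/-- `S`: all `s(i,j,k) = x_i u_{jk} - x_j u_{ik} + x_k u_{ij}`, `i < j < k`. -/
def relS (n : ℕ) (K : Type*) [Field K] : Set (PolyXU n K) :=
  {f | ∃ (i j k : Fin n) (hij : i < j) (hjk : j < k),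
    f = x K i * u K j k hjk - x K j * u K i k (hij.trans hjk) + x K k * u K i j hij}

/-- The ideal `(R, S)`. -/
noncomputable def relIdeal (n : ℕ) (K : Type*) [Field K] : Ideal (PolyXU n K) :=
  Ideal.span (relR n K ∪ relS n K)

/-! ### Monomials of `K[X,U]` -/

/-- The multiset `{i_1, …, i_c}` of the monomial `x_{i_1} ⋯ x_{i_c} u_{j_1k_1} ⋯ u_{j_dk_d}`. -/
noncomputable def xPart {n : ℕ} (v : Var n →₀ ℕ) : Multiset (Fin n) :=
  Finsupp.toMultiset (Finsupp.sumFinsuppAddEquivProdFinsupp v).1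

/-- The multiset `{(j_1,k_1), …, (j_d,k_d)}` of the monomial
`x_{i_1} ⋯ x_{i_c} u_{j_1k_1} ⋯ u_{j_dk_d}`. -/
noncomputable def uPart {n : ℕ} (v : Var n →₀ ℕ) : Multiset (Interval n) :=
  Finsupp.toMultiset (Finsupp.sumFinsuppAddEquivProdFinsupp v).2

/-- No two of the `u`'s of the monomial intersect, and no `u` of it covers an `x` of it. -/
def IsNoncrossing {n : ℕ} (v : Var n →₀ ℕ) : Prop :=
  (∀ p ∈ uPart v, ∀ q ∈ uPart v, ¬ p.Intersects q) ∧
    (∀ p ∈ uPart v, ∀ i ∈ xPart v, ¬ p.Covers i)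

/-! ### The degree--interval length--lexicographic (DILL) order -/

/-- The degree `c` of a monomial in `X`. -/
noncomputable def xDeg {n : ℕ} (v : Var n →₀ ℕ) : ℕ := (xPart v).card

/-- The degree `d` of a monomial in `U`. -/
noncomputable def uDeg {n : ℕ} (v : Var n →₀ ℕ) : ℕ := (uPart v).card

/-- The total interval length of a monomial. -/
noncomputable def totalLength {n : ℕ} (v : Var n →₀ ℕ) : ℕ :=
  ((uPart v).map Interval.length).sum

/-- The tuple `ω = (i_1, …, i_c, j_1, …, j_d, k_1, …, k_d)` of a monomial
`x_{i_1} ⋯ x_{i_c} u_{j_1k_1} ⋯ u_{j_dk_d}`, where `i_1 ≤ ⋯ ≤ i_c`, `j_1 ≤ ⋯ ≤ j_d`, and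
`k_a ≤ k_{a+1}` if `j_a = j_{a+1}`. -/
noncomputable def omega {n : ℕ} (v : Var n →₀ ℕ) : List (Fin n) :=
  (xPart v).sort ++
    ((uPart v).sort.map Interval.left ++ (uPart v).sort.map Interval.right)

/-- `DillGT v w` is `v ≻ w` in the DILL order. In the last clause `omega v` and `omega w` have the
same length, and the larger monomial is the one with the smaller tuple in the usual lexicographic
order of lists. -/
def DillGT {n : ℕ} (v w : Var n →₀ ℕ) : Prop :=
  xDeg v > xDeg w ∨
  (xDeg v = xDeg w ∧ uDeg v > uDeg w) ∨
  (xDeg v = xDeg w ∧ uDeg v = uDeg w ∧ totalLength v > totalLength w) ∨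
  (xDeg v = xDeg w ∧ uDeg v = uDeg w ∧ totalLength v = totalLength w ∧
    List.Lex (· < ·) (omega v) (omega w))

/-! The following facts show that the DILL order is an admissible order. -/

theorem xPart_add {n : ℕ} (v w : Var n →₀ ℕ) : xPart (v + w) = xPart v + xPart w := by
  simp only [xPart, map_add, Prod.fst_add]

theorem uPart_add {n : ℕ} (v w : Var n →₀ ℕ) : uPart (v + w) = uPart v + uPart w := by
  simp only [uPart, map_add, Prod.snd_add]

theorem part_injective {n : ℕ} {v w : Var n →₀ ℕ} (hx : xPart v = xPart w)
    (hu : uPart v = uPart w) : v = w := by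
  have h1 := Multiset.toFinsupp.symm.injective hx
  have h2 := Multiset.toFinsupp.symm.injective hu
  exact Finsupp.sumFinsuppAddEquivProdFinsupp.injective (Prod.ext h1 h2)

theorem append_lt_append_iff {β : Type*} [LinearOrder β] :
    ∀ {A A' : List β} (B B' : List β), A.length = A'.length →
      (A ++ B < A' ++ B' ↔ A < A' ∨ (A = A' ∧ B < B'))
  | [], [], B, B', _ => by simp
  | [], _ :: _, _, _, h => by simp at h
  | _ :: _, [], _, _, h => by simp at h
  | a :: A, a' :: A', B, B', h => by
    have ih := append_lt_append_iff (A := A) (A' := A') B B' (by simpa using h)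
    simp only [List.cons_append, List.cons_lt_cons_iff, ih, List.cons.injEq]
    tauto

theorem orderedInsert_lt {β : Type*} [LinearOrder β] (a : β) :
    ∀ {l l' : List β}, l.length = l'.length → l < l' →
      l.orderedInsert (· ≤ ·) a < l'.orderedInsert (· ≤ ·) a
  | [], [], _, h => by simp at h
  | [], _ :: _, h, _ => by simp at h
  | _ :: _, [], h, _ => by simp at h
  | b :: l, b' :: l', hl, h => by
    have ih := orderedInsert_lt a (l := l) (l' := l') (by simpa using hl)
    rw [List.cons_lt_cons_iff] at h
    simp only [List.orderedInsert_cons]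
    rcases h with h | ⟨rfl, h⟩
    · split_ifs with h1 h2 h2
      · simp [List.cons_lt_cons_iff, h]
      · exact absurd (h1.trans h.le) h2
      · simp [List.cons_lt_cons_iff, not_le.1 h1]
      · simp [List.cons_lt_cons_iff, h]
    · split_ifs with h1
      · simp [h]
      · simp [ih h]

theorem sort_cons_eq {β : Type*} [LinearOrder β] (a : β) (s : Multiset β) :
    (a ::ₘ s).sort = s.sort.orderedInsert (· ≤ ·) a := by
  apply List.Perm.eq_of_pairwise' (r := (· ≤ ·)) (Multiset.pairwise_sort _ _)
    ((Multiset.pairwise_sort s (· ≤ ·)).orderedInsert a _)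
  rw [← Multiset.coe_eq_coe, Multiset.sort_eq,
    Multiset.coe_eq_coe.2 (List.perm_orderedInsert (· ≤ ·) a _), ← Multiset.cons_coe,
    Multiset.sort_eq]

theorem sort_add_lt {β : Type*} [LinearOrder β] {s t : Multiset β} (h : s.card = t.card)
    (hst : s.sort < t.sort) (r : Multiset β) : (r + s).sort < (r + t).sort := by
  induction r using Multiset.induction_on with
  | empty => simpa using hst
  | cons a r ih =>
    rw [Multiset.cons_add, Multiset.cons_add, sort_cons_eq, sort_cons_eq]
    exact orderedInsert_lt a (by simp [h]) ih

theorem Interval.lt_iff' {n : ℕ} (p q : Interval n) :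
    p < q ↔ p.left < q.left ∨ (p.left = q.left ∧ p.right < q.right) := by
  rw [← Subtype.coe_lt_coe, Prod.Lex.lt_iff]
  rfl

theorem Interval.ext' {n : ℕ} {p q : Interval n} (h1 : p.left = q.left)
    (h2 : p.right = q.right) : p = q :=
  Subtype.ext (ofLex.injective (Prod.ext h1 h2))

theorem map_right_lt_iff {n : ℕ} :
    ∀ {L L' : List (Interval n)}, L.map Interval.left = L'.map Interval.left →
      (L.map Interval.right < L'.map Interval.right ↔ L < L')
  | [], [], _ => by simp
  | [], _ :: _, h => by simp at h
  | _ :: _, [], h => by simp at h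
  | p :: L, q :: L', h => by
    simp only [List.map_cons, List.cons.injEq] at h
    have ih := map_right_lt_iff h.2
    simp only [List.map_cons, List.cons_lt_cons_iff, ih, Interval.lt_iff', h.1, lt_irrefl,
      true_and, false_or]
    constructor
    · rintro (h' | ⟨h1, h2⟩)
      · exact Or.inl h'
      · exact Or.inr ⟨Interval.ext' h.1 h1, h2⟩
    · rintro (h' | ⟨h1, h2⟩)
      · exact Or.inl h'
      · exact Or.inr ⟨by rw [h1], h2⟩

theorem map_left_right_injective {n : ℕ} :
    ∀ {L L' : List (Interval n)}, L.map Interval.left = L'.map Interval.left →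
      L.map Interval.right = L'.map Interval.right → L = L'
  | [], [], _, _ => rfl
  | [], _ :: _, h, _ => by simp at h
  | _ :: _, [], h, _ => by simp at h
  | p :: L, q :: L', h, h' => by
    simp only [List.map_cons, List.cons.injEq] at h h'
    rw [map_left_right_injective h.2 h'.2, Interval.ext' h.1 h'.1]

theorem map_left_sort {n : ℕ} (s : Multiset (Interval n)) :
    s.sort.map Interval.left = (s.map Interval.left).sort := by
  apply List.Perm.eq_of_pairwise' (r := (· ≤ ·)) _ (Multiset.pairwise_sort _ _)
  · rw [← Multiset.coe_eq_coe, Multiset.sort_eq, ← Multiset.map_coe, Multiset.sort_eq]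
  · rw [List.pairwise_map]
    refine (Multiset.pairwise_sort s (· ≤ ·)).imp ?_
    intro p q h
    rcases h.lt_or_eq with h | h
    · rcases (Interval.lt_iff' p q).1 h with h | h
      · exact h.le
      · exact h.1.le
    · rw [h]

theorem omega_lt_iff {n : ℕ} {v w : Var n →₀ ℕ} (hx : xDeg v = xDeg w) (hu : uDeg v = uDeg w) :
    omega v < omega w ↔ (xPart v).sort < (xPart w).sort ∨ (xPart v = xPart w ∧
      (((uPart v).map Interval.left).sort < ((uPart w).map Interval.left).sort ∨
        ((uPart v).map Interval.left = (uPart w).map Interval.left ∧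
          (uPart v).sort < (uPart w).sort))) := by
  have key : ∀ {β : Type} [LinearOrder β] (s t : Multiset β), s.sort = t.sort ↔ s = t := by
    intro β _ s t
    constructor
    · intro h
      rw [← Multiset.sort_eq s (· ≤ ·), h, Multiset.sort_eq]
    · intro h
      rw [h]
  unfold omega
  rw [append_lt_append_iff _ _ (by simpa [xDeg] using hx), append_lt_append_iff _ _ (by simpa [uDeg] using hu),
    key, map_left_sort, map_left_sort, key]
  have : (uPart v).map Interval.left = (uPart w).map Interval.left →
      ((uPart v).sort.map Interval.right < (uPart w).sort.map Interval.right ↔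
        (uPart v).sort < (uPart w).sort) := by
    intro h
    apply map_right_lt_iff
    rw [map_left_sort, map_left_sort, h]
  tauto

theorem omega_add_lt {n : ℕ} {v w : Var n →₀ ℕ} (hx : xDeg v = xDeg w) (hu : uDeg v = uDeg w)
    (h : omega v < omega w) (r : Var n →₀ ℕ) : omega (r + v) < omega (r + w) := by
  rw [omega_lt_iff hx hu] at h
  unfold xDeg at hx
  unfold uDeg at hu
  rw [omega_lt_iff (by simp [xDeg, xPart_add, hx]) (by simp [uDeg, uPart_add, hu])]
  simp only [xPart_add, uPart_add, Multiset.map_add]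
  rcases h with h | ⟨h0, h | ⟨h1, h⟩⟩
  · exact Or.inl (sort_add_lt hx h _)
  · exact Or.inr ⟨by rw [h0], Or.inl (sort_add_lt (by simpa using hu) h _)⟩
  · exact Or.inr ⟨by rw [h0], Or.inr ⟨by rw [h1], sort_add_lt hu h _⟩⟩

/-- The monomials of `K[X,U]`, as the carrier of the DILL order. -/
def DillSyn (n : ℕ) := Var n →₀ ℕ

noncomputable instance (n : ℕ) : AddCommMonoid (DillSyn n) :=
  inferInstanceAs (AddCommMonoid (Var n →₀ ℕ))

/-- The data by which the DILL order compares monomials, lexicographically. -/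
noncomputable def dillKey {n : ℕ} (v : Var n →₀ ℕ) : ℕ ×ₗ ℕ ×ₗ ℕ ×ₗ (List (Fin n))ᵒᵈ :=
  toLex (xDeg v, toLex (uDeg v, toLex (totalLength v, OrderDual.toDual (omega v))))

theorem dillKey_lt_iff {n : ℕ} (v w : Var n →₀ ℕ) : dillKey w < dillKey v ↔ DillGT v w := by
  have h : OrderDual.toDual (omega w) < OrderDual.toDual (omega v) ↔
    List.Lex (· < ·) (omega v) (omega w) := Iff.rfl
  simp only [dillKey, Prod.Lex.toLex_lt_toLex, h, DillGT, gt_iff_lt, eq_comm (a := xDeg w),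
    eq_comm (a := uDeg w), eq_comm (a := totalLength w)]
  tauto

theorem dillKey_injective (n : ℕ) : Function.Injective (dillKey (n := n)) := by
  intro v w h
  simp only [dillKey, EmbeddingLike.apply_eq_iff_eq, Prod.mk.injEq] at h
  obtain ⟨hx, hu, -, h⟩ := h
  unfold omega at h
  obtain ⟨h1, h2⟩ := List.append_inj h (by simpa [xDeg] using hx)
  obtain ⟨h3, h4⟩ := List.append_inj h2 (by simpa [uDeg] using hu)
  apply part_injective
  · rw [← Multiset.sort_eq (xPart v) (· ≤ ·), h1, Multiset.sort_eq]
  · rw [← Multiset.sort_eq (uPart v) (· ≤ ·), map_left_right_injective h3 h4, Multiset.sort_eq]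

noncomputable instance (n : ℕ) : LinearOrder (DillSyn n) :=
  LinearOrder.lift' (fun v : DillSyn n => dillKey (n := n) v) (dillKey_injective n)

theorem dillSyn_lt_iff {n : ℕ} (v w : DillSyn n) : w < v ↔ DillGT (n := n) v w :=
  dillKey_lt_iff (n := n) v w

theorem dillGT_add {n : ℕ} {v w : Var n →₀ ℕ} (h : DillGT v w) (r : Var n →₀ ℕ) :
    DillGT (r + v) (r + w) := by
  have hx : ∀ v : Var n →₀ ℕ, xDeg (r + v) = xDeg r + xDeg v := by simp [xDeg, xPart_add]
  have hu : ∀ v : Var n →₀ ℕ, uDeg (r + v) = uDeg r + uDeg v := by simp [uDeg, uPart_add]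
  have ht : ∀ v : Var n →₀ ℕ, totalLength (r + v) = totalLength r + totalLength v := by
    simp [totalLength, uPart_add]
  unfold DillGT at *
  simp only [hx, hu, ht]
  rcases h with h | h | h | ⟨h1, h2, h3, h4⟩
  · omega
  · omega
  · omega
  · exact Or.inr (Or.inr (Or.inr ⟨by rw [h1], by rw [h2], by rw [h3], omega_add_lt h1 h2 h4 r⟩))

instance (n : ℕ) : IsOrderedAddMonoid (DillSyn n) where
  add_le_add_left a b h c := by
    rcases h.lt_or_eq with h | h
    · rw [dillSyn_lt_iff] at h
      rw [add_comm a c, add_comm b c]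
      exact ((dillSyn_lt_iff _ _).2 (dillGT_add h c)).le
    · rw [h]

theorem not_dillGT_zero {n : ℕ} (v : Var n →₀ ℕ) : ¬ DillGT 0 v := by
  intro h
  have hx : xDeg (0 : Var n →₀ ℕ) = 0 := by simp [xDeg, xPart]
  have hu : uDeg (0 : Var n →₀ ℕ) = 0 := by simp [uDeg, uPart]
  have ht : totalLength (0 : Var n →₀ ℕ) = 0 := by simp [totalLength, uPart]
  have ho : omega (0 : Var n →₀ ℕ) = [] := by simp [omega, xPart, uPart]
  unfold DillGT at h
  rw [hx, hu, ht, ho] at h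
  rcases h with h | h | h | ⟨h1, h2, -, h4⟩
  · simp at h
  · simp at h
  · simp at h
  · have h3 : omega v = [] := by
      have h1 := Multiset.card_eq_zero.1 h1.symm
      have h2 := Multiset.card_eq_zero.1 h2.symm
      simp [omega, h1, h2]
    rw [h3] at h4
    cases h4

theorem dillSyn_nonneg {n : ℕ} (v : DillSyn n) : 0 ≤ v :=
  not_lt.1 fun h => not_dillGT_zero (n := n) v ((dillSyn_lt_iff _ _).1 h)

/-- The identity map from the monomials of `K[X,U]` to the carrier of the DILL order. -/
noncomputable def toDillSyn (n : ℕ) : (Var n →₀ ℕ) ≃+ DillSyn n where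
  toFun := fun v => v
  invFun := fun v => v
  left_inv := fun _ => rfl
  right_inv := fun _ => rfl
  map_add' := fun _ _ => rfl

theorem toDillSyn_monotone (n : ℕ) : Monotone (toDillSyn n) := by
  intro v w h
  obtain ⟨r, rfl⟩ := exists_add_of_le h
  rw [map_add]
  exact le_add_of_nonneg_right (dillSyn_nonneg _)

instance (n : ℕ) : WellFoundedLT (DillSyn n) :=
  haveI : WellQuasiOrderedLE (DillSyn n) :=
    Monotone.wellQuasiOrderedLE_of_wellQuasiOrderedLE_of_surjective (toDillSyn_monotone n) (toDillSyn n).surjective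
  inferInstance

/-- The DILL order as a monomial order on `K[X,U]`. -/
noncomputable def dill (n : ℕ) : MonomialOrder (Var n) where
  syn := DillSyn n
  toSyn := toDillSyn n
  toSyn_monotone := toDillSyn_monotone n

theorem dill_lt_iff {n : ℕ} (v w : Var n →₀ ℕ) :
    (dill n).toSyn w < (dill n).toSyn v ↔ DillGT v w :=
  dillSyn_lt_iff (n := n) v w

/-! ### Gröbner bases -/

/-- `G` is a Gröbner basis of the ideal `J` with respect to the monomial order `m`: it is a set of
nonzero polynomials that generates `J`, and the leading monomial of every nonzero `f ∈ J` is
divisible by the leading monomial of some `g ∈ G`. -/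
structure IsGroebnerBasis {σ K : Type*} [Field K] (m : MonomialOrder σ)
    (G : Set (MvPolynomial σ K)) (J : Ideal (MvPolynomial σ K)) : Prop where
  zero_notMem : 0 ∉ G
  span_eq : Ideal.span G = J
  exists_degree_le : ∀ f ∈ J, f ≠ 0 → ∃ g ∈ G, m.degree g ≤ m.degree f

/-- A Gröbner basis `G` is reduced if no monomial participating in an `f ∈ G` is divisible by the
leading monomial of an element of `G \ {f}`. -/
structure IsReducedGroebnerBasis {σ K : Type*} [Field K] (m : MonomialOrder σ)
    (G : Set (MvPolynomial σ K)) (J : Ideal (MvPolynomial σ K)) : Prop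
    extends IsGroebnerBasis m G J where
  not_degree_le : ∀ f ∈ G, ∀ v ∈ f.support, ∀ g ∈ G \ {f}, ¬ m.degree g ≤ v

end Nowicki

namespace Nowicki

open MvPolynomial

/-! ### Noncrossing monomials are determined by their end points -/

/-! Two monomial orders are played against each other. On `K[X,U]`, the DILL leading monomial of
each generator is its unique crossing monomial, and every crossing monomial is divisible by one of
these. Division by `R ∪ S` therefore leaves a remainder supported on noncrossing monomials.

On `K[X,Y]`, under the lexicographic order with all `y` above all `x`, the leading term of
`π(u_{jk})` is `-x_k y_j`. The leading exponent `lead v` of the image of a monomial thus records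
only the left ends and the merged multiset of `x`-indices and right ends. A noncrossing monomial can
be recovered from this (`lead_injOn`), so `π` is injective on the span of noncrossing monomials
(`piHom_ne_zero_of_noncrossing`). Hence remainders of kernel elements vanish: `ker π = (R, S)`, and
the degree bounds of the division algorithm give the Gröbner property without computing
S-polynomials.

Every `π(f)` is a constant. For the converse, after multiplication by a power of `x_1`, every
polynomial becomes a polynomial in `y_1` over the image of `π`. In characteristic `0` a constant
cannot involve `y_1` there, so `x_1^m f` lies in the image (`exists_pow_mul_mem_range`). The power
of `x_1` is removed on leading exponents: `1` is never a right end, so `x_1^m` splits off the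
noncrossing monomial itself (`exists_degree_eq_lead`). Thus every nonzero constant has the leading
exponent of a noncrossing image, and subtracting leading terms shows that these images span. -/

/-- If `a < p.right`, then `a` is not in `A`, since `p` would cover it. So `a` is the right end of
some `q`, and `q.left < p.left` would make `q` intersect `p`; maximality of `p.left` leaves only
equality. The interval found is determined by the end points alone. -/
theorem exists_mem_left_right {n : ℕ} {A : Multiset (Fin n)} {U : Multiset (Interval n)}
    (hU : ∀ p ∈ U, ∀ q ∈ U, ¬ p.Intersects q) (hA : ∀ p ∈ U, ∀ i ∈ A, ¬ p.Covers i)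
    {p : Interval n} (hp : p ∈ U) (hmax : ∀ q ∈ U, q.left ≤ p.left) {a : Fin n}
    (ha : a ∈ A + U.map Interval.right) (hpa : p.left < a)
    (hmin : ∀ b ∈ A + U.map Interval.right, p.left < b → a ≤ b) :
    ∃ r ∈ U, r.left = p.left ∧ r.right = a := by
  have hle : a ≤ p.right :=
    hmin _ (Multiset.mem_add.2 (Or.inr (Multiset.mem_map_of_mem _ hp))) p.2
  rcases hle.eq_or_lt with h | h
  · exact ⟨p, hp, rfl, h.symm⟩
  rcases Multiset.mem_add.1 ha with ha | ha
  · exact absurd ⟨hpa, h⟩ (hA p hp a ha)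
  obtain ⟨q, hq, rfl⟩ := Multiset.mem_map.1 ha
  rcases (hmax q hq).eq_or_lt with h' | h'
  · exact ⟨q, hq, h', rfl⟩
  · exact absurd (Or.inl ⟨h', hpa, h⟩) (hU q hq p hp)

/-- The greatest left end must be paired with the nearest available point to its right. Both `U` and
`U'` contain this interval; removing it from each preserves all hypotheses. -/
theorem noncrossing_unique {n : ℕ} (m : ℕ) : ∀ {A A' : Multiset (Fin n)}
    {U U' : Multiset (Interval n)}, U.card = m →
    (∀ p ∈ U, ∀ q ∈ U, ¬ p.Intersects q) → (∀ p ∈ U, ∀ i ∈ A, ¬ p.Covers i) →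
    (∀ p ∈ U', ∀ q ∈ U', ¬ p.Intersects q) → (∀ p ∈ U', ∀ i ∈ A', ¬ p.Covers i) →
    A + U.map Interval.right = A' + U'.map Interval.right →
    U.map Interval.left = U'.map Interval.left → U = U' := by
  induction m with
  | zero =>
    intro A A' U U' hm _ _ _ _ _ hl
    have h := congrArg Multiset.card hl
    rw [Multiset.card_map, Multiset.card_map, hm] at h
    rw [Multiset.card_eq_zero.1 hm, Multiset.card_eq_zero.1 h.symm]
  | succ m ih =>
    intro A A' U U' hm hU hA hU' hA' hr hl
    have hne : U ≠ 0 := by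
      rintro rfl
      simp at hm
    obtain ⟨p, hp, hmax⟩ : ∃ p ∈ U, ∀ q ∈ U, q.left ≤ p.left := by
      obtain ⟨p, hp, h⟩ := Finset.exists_max_image U.toFinset Interval.left
        (by simpa using hne)
      exact ⟨p, by simpa using hp, fun q hq => h q (by simpa using hq)⟩
    obtain ⟨p', hp', hpp⟩ : ∃ p' ∈ U', p'.left = p.left := by
      have : p.left ∈ U'.map Interval.left := hl ▸ Multiset.mem_map_of_mem _ hp
      simpa using this
    have hmax' : ∀ q ∈ U', q.left ≤ p'.left := by
      intro q hq
      have : q.left ∈ U.map Interval.left := hl ▸ Multiset.mem_map_of_mem _ hq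
      obtain ⟨r, hr, hrq⟩ := Multiset.mem_map.1 this
      rw [hpp, ← hrq]
      exact hmax r hr
    obtain ⟨a, ha, hmin⟩ := Finset.exists_min_image
      ((A + U.map Interval.right).toFinset.filter (p.left < ·)) id
      ⟨p.right, by
        simp only [Finset.mem_filter, Multiset.mem_toFinset, Multiset.mem_add]
        exact ⟨Or.inr (Multiset.mem_map_of_mem _ hp), p.2⟩⟩
    simp only [Finset.mem_filter, Multiset.mem_toFinset, id, and_imp] at ha hmin
    obtain ⟨r, hrU, hrl, hrr⟩ := exists_mem_left_right hU hA hp hmax ha.1 ha.2 hmin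
    obtain ⟨r', hrU', hrl', hrr'⟩ := exists_mem_left_right hU' hA' hp' hmax' (hr ▸ ha.1)
      (hpp ▸ ha.2) (hr ▸ hpp ▸ hmin)
    obtain rfl : r = r' := Interval.ext' (by rw [hrl, hrl', hpp]) (by rw [hrr, hrr'])
    obtain ⟨V, rfl⟩ := Multiset.exists_cons_of_mem hrU
    obtain ⟨V', rfl⟩ := Multiset.exists_cons_of_mem hrU'
    have hV : ∀ {q : Interval n} {W : Multiset (Interval n)}, q ∈ W → q ∈ r ::ₘ W :=
      fun h => Multiset.mem_cons_of_mem h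
    rw [ih (A := A) (A' := A') (by simpa using hm)
      (fun q hq s hs => hU q (hV hq) s (hV hs)) (fun q hq => hA q (hV hq))
      (fun q hq s hs => hU' q (hV hq) s (hV hs)) (fun q hq => hA' q (hV hq))
      (by simpa using hr) (by simpa using hl)]

/-- The exponent of the leading monomial `∏ x_i ∏ x_k y_j` of the image under `π` of the monomial
`∏ x_i ∏ u_{jk}`. -/
noncomputable def lead {n : ℕ} (v : Var n →₀ ℕ) : Fin n ⊕ Fin n →₀ ℕ :=
  Finsupp.sumFinsuppAddEquivProdFinsupp.symm
    (Multiset.toFinsupp (xPart v + (uPart v).map Interval.right),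
      Multiset.toFinsupp ((uPart v).map Interval.left))

theorem lead_injOn (n : ℕ) : Set.InjOn (lead (n := n)) {v | IsNoncrossing v} := by
  intro v hv w hw h
  have h' := Finsupp.sumFinsuppAddEquivProdFinsupp.symm.injective h
  rw [Prod.mk.injEq] at h'
  have hr := Multiset.toFinsupp.injective h'.1
  have hu := noncrossing_unique _ rfl hv.1 hv.2 hw.1 hw.2 hr (Multiset.toFinsupp.injective h'.2)
  rw [hu] at hr
  exact part_injective (add_right_cancel hr) hu

theorem lead_zero (n : ℕ) : lead (0 : Var n →₀ ℕ) = 0 := by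
  simp [lead, xPart, uPart, ← Prod.zero_eq_mk]

theorem lead_add {n : ℕ} (v w : Var n →₀ ℕ) : lead (v + w) = lead v + lead w := by
  unfold lead
  rw [← map_add, Prod.mk_add_mk, ← map_add, ← map_add, xPart_add, uPart_add, Multiset.map_add,
    Multiset.map_add]
  congr 3
  abel

theorem lead_nsmul {n : ℕ} (m : ℕ) (v : Var n →₀ ℕ) : lead (m • v) = m • lead v := by
  induction m with
  | zero => simp [lead_zero]
  | succ m ih => rw [succ_nsmul, succ_nsmul, lead_add, ih]

theorem xPart_single_inl {n : ℕ} (i : Fin n) : xPart (Finsupp.single (Sum.inl i) 1) = {i} := by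
  have : (Finsupp.sumFinsuppAddEquivProdFinsupp
      (Finsupp.single (Sum.inl i : Var n) (1 : ℕ))).1 = Finsupp.single i 1 := by
    ext j
    simp [Finsupp.single_apply]
  rw [xPart, this, Finsupp.toMultiset_single, one_nsmul]

theorem uPart_single_inl {n : ℕ} (i : Fin n) : uPart (Finsupp.single (Sum.inl i) 1) = 0 := by
  have : (Finsupp.sumFinsuppAddEquivProdFinsupp
      (Finsupp.single (Sum.inl i : Var n) (1 : ℕ))).2 = 0 := by
    ext j
    simp
  rw [uPart, this, map_zero]

theorem xPart_single_inr {n : ℕ} (p : Interval n) : xPart (Finsupp.single (Sum.inr p) 1) = 0 := by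
  have : (Finsupp.sumFinsuppAddEquivProdFinsupp
      (Finsupp.single (Sum.inr p : Var n) (1 : ℕ))).1 = 0 := by
    ext j
    simp
  rw [xPart, this, map_zero]

theorem uPart_single_inr {n : ℕ} (p : Interval n) :
    uPart (Finsupp.single (Sum.inr p) 1) = {p} := by
  have : (Finsupp.sumFinsuppAddEquivProdFinsupp
      (Finsupp.single (Sum.inr p : Var n) (1 : ℕ))).2 = Finsupp.single p 1 := by
    ext j
    simp [Finsupp.single_apply]
  rw [uPart, this, Finsupp.toMultiset_single, one_nsmul]

theorem lead_single_inl {n : ℕ} (i : Fin n) :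
    lead (Finsupp.single (Sum.inl i) 1) = Finsupp.single (Sum.inl i) 1 := by
  rw [lead, xPart_single_inl, uPart_single_inl]
  ext (j | j) <;> simp [Finsupp.single_apply]

theorem lead_single_inr {n : ℕ} (p : Interval n) :
    lead (Finsupp.single (Sum.inr p) 1) =
      Finsupp.single (Sum.inl p.right) 1 + Finsupp.single (Sum.inr p.left) 1 := by
  rw [lead, xPart_single_inr, uPart_single_inr]
  ext (j | j) <;> simp [Finsupp.single_apply]

/-! ### Leading monomials in `K[X,Y]` -/

/-- The linear order `y_1, …, y_n, x_1, …, x_n` of the variables of `K[X,Y]`. -/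
noncomputable abbrev xyLinearOrder (n : ℕ) : LinearOrder (Fin n ⊕ Fin n) :=
  LinearOrder.lift' (fun v => (toLex v.swap : Fin n ⊕ₗ Fin n))
    (toLex.injective.comp Sum.swap_leftInverse.injective)

/-- The lexicographic order of `K[X,Y]` with `y_1 ≻ ⋯ ≻ y_n ≻ x_1 ≻ ⋯ ≻ x_n`. -/
noncomputable def xyOrder (n : ℕ) : MonomialOrder (Fin n ⊕ Fin n) :=
  @MonomialOrder.lex _ (xyLinearOrder n)
    (@Finite.to_wellFoundedGT _ _ (xyLinearOrder n).toPreorder)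

theorem xyOrder_lt_iff {n : ℕ} (v w : Fin n ⊕ Fin n →₀ ℕ) :
    (xyOrder n).toSyn v < (xyOrder n).toSyn w ↔
      ∃ a, (∀ b, (xyLinearOrder n).lt b a → v b = w b) ∧ v a < w a :=
  @Finsupp.Lex.lt_iff _ _ _ (xyLinearOrder n).toLT _ _ _

theorem xyOrder_lt {n : ℕ} {i j : Fin n} (h : i < j) :
    (xyOrder n).toSyn (Finsupp.single (Sum.inl i) 1 + Finsupp.single (Sum.inr j) 1) <
      (xyOrder n).toSyn (Finsupp.single (Sum.inl j) 1 + Finsupp.single (Sum.inr i) 1) := by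
  -- Since `i < j`, the greatest variable in which the two monomials differ is `y_i`.
  refine (xyOrder_lt_iff _ _).2 ⟨Sum.inr i, ?_, ?_⟩
  · rintro (k | k) hk
    · exact absurd (show (toLex (Sum.inr k) : Fin n ⊕ₗ Fin n) < toLex (Sum.inl i) from hk)
        Sum.Lex.not_inr_lt_inl
    · have hk : k < i :=
        Sum.Lex.inl_lt_inl_iff.1
          (show (toLex (Sum.inl k) : Fin n ⊕ₗ Fin n) < toLex (Sum.inl i) from hk)
      simp [hk.ne', (hk.trans h).ne']
  · simp [h.ne']

/-! ### Leading monomials of images under `π`, and independence of the noncrossing ones -/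

section Degree

variable {n : ℕ} {K : Type*} [Field K]

theorem piHom_X_inl (i : Fin n) : piHom n K (X (Sum.inl i)) = X (Sum.inl i) := by
  simp [piHom]

theorem piHom_X_inr (p : Interval n) : piHom n K (X (Sum.inr p)) =
    X (Sum.inl p.left) * X (Sum.inr p.right) - X (Sum.inl p.right) * X (Sum.inr p.left) := by
  simp [piHom]

theorem degree_piHom_X (a : Var n) :
    (xyOrder n).degree (piHom n K (X a)) = lead (Finsupp.single a 1) ∧
      piHom n K (X a) ≠ 0 := by
  have hX : ∀ i j : Fin n, (xyOrder n).degree (X (Sum.inl i) * X (Sum.inr j) : PolyXY n K) =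
      Finsupp.single (Sum.inl i) 1 + Finsupp.single (Sum.inr j) 1 := by
    intro i j
    rw [MonomialOrder.degree_mul (X_ne_zero _) (X_ne_zero _), MonomialOrder.degree_X,
      MonomialOrder.degree_X]
  rcases a with i | p
  · rw [piHom_X_inl, lead_single_inl, MonomialOrder.degree_X]
    exact ⟨rfl, X_ne_zero _⟩
  · have h : (xyOrder n).degree (piHom n K (X (Sum.inr p))) =
        lead (Finsupp.single (Sum.inr p) 1) := by
      -- The second term dominates because it contains `y` at the left end; the sign change puts it
      -- first.
      rw [piHom_X_inr, lead_single_inr, ← neg_sub, MonomialOrder.degree_neg,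
        MonomialOrder.degree_sub_of_lt, hX]
      rw [hX, hX]
      exact xyOrder_lt p.2
    refine ⟨h, (xyOrder n).ne_zero_of_degree_ne_zero ?_⟩
    rw [h, lead_single_inr]
    intro h0
    have := DFunLike.congr_fun h0 (Sum.inl p.right)
    simp at this

theorem degree_piHom_monomial (v : Var n →₀ ℕ) :
    (xyOrder n).degree (piHom n K (monomial v 1)) = lead v ∧ piHom n K (monomial v 1) ≠ 0 := by
  induction v using Finsupp.induction_linear with
  | zero => simp [lead_zero]
  | add v w hv hw =>
    have : (monomial (v + w) 1 : PolyXU n K) = monomial v 1 * monomial w 1 := by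
      rw [monomial_mul, one_mul]
    rw [this, map_mul, MonomialOrder.degree_mul hv.2 hw.2, hv.1, hw.1, lead_add]
    exact ⟨rfl, mul_ne_zero hv.2 hw.2⟩
  | single a m =>
    have h := degree_piHom_X (K := K) a
    have hs : Finsupp.single a m = m • Finsupp.single a 1 := by simp
    rw [← X_pow_eq_monomial, map_pow, MonomialOrder.degree_pow, h.1, hs, lead_nsmul]
    exact ⟨rfl, pow_ne_zero _ h.2⟩

/-- Leading monomials that are pairwise different cannot cancel: the greatest of them occurs in
exactly one summand. -/
theorem sum_smul_ne_zero_and_degree {σ ι : Type*} (m : MonomialOrder σ)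
    {f : ι → MvPolynomial σ K} {s : Finset ι} (hs : s.Nonempty) {c : ι → K}
    (hc : ∀ i ∈ s, c i ≠ 0) (hf : ∀ i ∈ s, f i ≠ 0)
    (hinj : Set.InjOn (fun i => m.degree (f i)) s) :
    ∑ i ∈ s, c i • f i ≠ 0 ∧ ∃ i ∈ s, m.degree (∑ i ∈ s, c i • f i) = m.degree (f i) := by
  obtain ⟨i, hi, hmax⟩ := Finset.exists_max_image s (fun i => m.toSyn (m.degree (f i))) hs
  have h1 : coeff (m.degree (f i)) (∑ j ∈ s, c j • f j) ≠ 0 := by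
    rw [coeff_sum, Finset.sum_eq_single_of_mem i hi]
    · rw [coeff_smul, smul_eq_mul]
      exact mul_ne_zero (hc i hi) (m.coeff_degree_ne_zero_iff.2 (hf i hi))
    · intro j hj hji
      rw [coeff_smul, m.coeff_eq_zero_of_lt, smul_zero]
      refine lt_of_le_of_ne (hmax j hj) fun h => hji (hinj hj hi (m.toSyn.injective h))
  refine ⟨fun h => h1 (by rw [h, coeff_zero]), i, hi, m.toSyn.injective (le_antisymm ?_ ?_)⟩
  · rw [m.degree_le_iff]
    intro d hd
    rw [mem_support_iff, coeff_sum] at hd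
    obtain ⟨j, hj, hjd⟩ := Finset.exists_ne_zero_of_sum_ne_zero hd
    rw [coeff_smul, smul_ne_zero_iff] at hjd
    exact (m.le_degree (mem_support_iff.2 hjd.2)).trans (hmax j hj)
  · exact m.le_degree (mem_support_iff.2 h1)

/-- Injectivity of `lead` on noncrossing monomials makes the leading exponents of the images
distinct, so the greatest one survives. This replaces any direct computation of the kernel. -/
theorem piHom_ne_zero_of_noncrossing {f : PolyXU n K} (hf : f ≠ 0)
    (h : ∀ v ∈ f.support, IsNoncrossing v) :
    piHom n K f ≠ 0 ∧ ∃ v, IsNoncrossing v ∧ (xyOrder n).degree (piHom n K f) = lead v := by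
  have hsum : piHom n K f = ∑ v ∈ f.support, coeff v f • piHom n K (monomial v 1) := by
    conv_lhs => rw [f.as_sum, map_sum]
    refine Finset.sum_congr rfl fun v _ => ?_
    rw [← map_smul, smul_monomial, smul_eq_mul, mul_one]
  obtain ⟨h1, v, hv, h2⟩ := sum_smul_ne_zero_and_degree (K := K) (xyOrder n)
    (f := fun v => piHom n K (monomial v 1)) (s := f.support) (c := fun v => coeff v f)
    (by simpa using hf) (fun v hv => mem_support_iff.1 hv)
    (fun v _ => (degree_piHom_monomial v).2) (fun v hv w hw hvw => by
      simp only [(degree_piHom_monomial (K := K) _).1] at hvw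
      exact lead_injOn n (h v hv) (h w hw) hvw)
  rw [hsum]
  exact ⟨h1, v, h v hv, h2.trans (degree_piHom_monomial v).1⟩

theorem linearIndependent_piHom_noncrossing (n : ℕ) (K : Type*) [Field K] :
    LinearIndependent K fun v : {v : Var n →₀ ℕ // IsNoncrossing v} =>
      piHom n K (monomial (v : Var n →₀ ℕ) 1) := by
  rw [linearIndependent_iff]
  intro l hl
  by_contra h0
  refine (sum_smul_ne_zero_and_degree (K := K) (xyOrder n)
    (f := fun v : {v : Var n →₀ ℕ // IsNoncrossing v} =>
      piHom n K (monomial (v : Var n →₀ ℕ) 1)) (s := l.support) (c := l)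
    (by simpa using h0) (fun v hv => Finsupp.mem_support_iff.1 hv)
    (fun v _ => (degree_piHom_monomial _).2) (fun v _ w _ hvw => ?_)).1 hl
  simp only [(degree_piHom_monomial (K := K) _).1] at hvw
  exact Subtype.ext (lead_injOn n v.2 w.2 hvw)

end Degree

/-! ### The leading monomials of `R` and `S` -/

theorem IsNoncrossing.mono {n : ℕ} {v w : Var n →₀ ℕ} (hw : IsNoncrossing w) (h : v ≤ w) :
    IsNoncrossing v := by
  obtain ⟨r, rfl⟩ := exists_add_of_le h
  unfold IsNoncrossing at *
  simp only [xPart_add, uPart_add, Multiset.mem_add] at hw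
  exact ⟨fun p hp q hq => hw.1 p (Or.inl hp) q (Or.inl hq),
    fun p hp i hi => hw.2 p (Or.inl hp) i (Or.inl hi)⟩

theorem mem_xPart {n : ℕ} {v : Var n →₀ ℕ} {i : Fin n} : i ∈ xPart v ↔ v (Sum.inl i) ≠ 0 := by
  rw [xPart, Finsupp.mem_toMultiset, Finsupp.mem_support_iff,
    Finsupp.fst_sumFinsuppAddEquivProdFinsupp]

theorem mem_uPart {n : ℕ} {v : Var n →₀ ℕ} {p : Interval n} :
    p ∈ uPart v ↔ v (Sum.inr p) ≠ 0 := by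
  rw [uPart, Finsupp.mem_toMultiset, Finsupp.mem_support_iff,
    Finsupp.snd_sumFinsuppAddEquivProdFinsupp]

theorem single_add_single_le {ι : Type*} {v : ι →₀ ℕ} {a b : ι} (hab : a ≠ b) (ha : v a ≠ 0)
    (hb : v b ≠ 0) : Finsupp.single a 1 + Finsupp.single b 1 ≤ v := by
  classical
  intro c
  simp only [Finsupp.add_apply, Finsupp.single_apply]
  split_ifs with h1 h2 h2
  · exact absurd (h1.trans h2.symm) hab
  · subst h1; lia
  · subst h2; lia
  · lia

/-- The relations of `R` and `S` have the form `a - b + c` with noncrossing monomials `a`, `c`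
and a crossing leading monomial `b` of degree two. -/
structure IsRelation {n : ℕ} (a b c : Var n →₀ ℕ) : Prop where
  left_gt : DillGT b a
  right_gt : DillGT b c
  left_noncrossing : IsNoncrossing a
  right_noncrossing : IsNoncrossing c
  not_noncrossing : ¬ IsNoncrossing b
  degree_eq : b.degree = 2

/-- The index of the variable `u_{ij}`. -/
abbrev interval {n : ℕ} {i j : Fin n} (h : i < j) : Interval n := ⟨toLex (i, j), h⟩

/-- The monomial `u_p u_q`. -/
noncomputable def uuMon {n : ℕ} (p q : Interval n) : Var n →₀ ℕ :=
  Finsupp.single (Sum.inr p) 1 + Finsupp.single (Sum.inr q) 1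

/-- The monomial `x_i u_p`. -/
noncomputable def xuMon {n : ℕ} (i : Fin n) (p : Interval n) : Var n →₀ ℕ :=
  Finsupp.single (Sum.inl i) 1 + Finsupp.single (Sum.inr p) 1

section

variable {n : ℕ}

theorem xPart_uuMon (p q : Interval n) : xPart (uuMon p q) = 0 := by
  rw [uuMon, xPart_add, xPart_single_inr, xPart_single_inr, add_zero]

theorem uPart_uuMon (p q : Interval n) : uPart (uuMon p q) = {p, q} := by
  rw [uuMon, uPart_add, uPart_single_inr, uPart_single_inr]
  rfl

theorem xPart_xuMon (i : Fin n) (p : Interval n) : xPart (xuMon i p) = {i} := by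
  rw [xuMon, xPart_add, xPart_single_inl, xPart_single_inr, add_zero]

theorem uPart_xuMon (i : Fin n) (p : Interval n) : uPart (xuMon i p) = {p} := by
  rw [xuMon, uPart_add, uPart_single_inl, uPart_single_inr, zero_add]

theorem isRelation_relR {i j k l : Fin n} (hij : i < j) (hjk : j < k) (hkl : k < l) :
    IsRelation (uuMon (interval hij) (interval hkl))
      (uuMon (interval (hij.trans hjk)) (interval (hjk.trans hkl)))
      (uuMon (interval ((hij.trans hjk).trans hkl)) (interval hjk)) where
  left_gt := by
    refine Or.inr (Or.inr (Or.inl ⟨?_, ?_, ?_⟩))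
    · simp [xDeg, xPart_uuMon]
    · simp [uDeg, uPart_uuMon]
    · simp only [totalLength, uPart_uuMon, Multiset.insert_eq_cons, Multiset.map_cons,
        Multiset.map_singleton, Multiset.sum_cons, Multiset.sum_singleton, Interval.length,
        Interval.left, Interval.right, ofLex_toLex]
      rw [Fin.lt_def] at hij hjk hkl
      lia
  right_gt := by
    have hx : xDeg (uuMon (interval (hij.trans hjk)) (interval (hjk.trans hkl))) =
        xDeg (uuMon (interval ((hij.trans hjk).trans hkl)) (interval hjk)) := by
      simp [xDeg, xPart_uuMon]
    have hu : uDeg (uuMon (interval (hij.trans hjk)) (interval (hjk.trans hkl))) =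
        uDeg (uuMon (interval ((hij.trans hjk).trans hkl)) (interval hjk)) := by
      simp [uDeg, uPart_uuMon]
    -- Total lengths tie, and both monomials have left ends `i, j`. The partner of `i` decides: `k <
    -- l`, and the smaller tuple belongs to the greater monomial.
    refine Or.inr (Or.inr (Or.inr ⟨hx, hu, ?_, (omega_lt_iff hx hu).2 (Or.inr ⟨?_, Or.inr ⟨?_, ?_⟩⟩)⟩))
    · simp only [totalLength, uPart_uuMon, Multiset.insert_eq_cons, Multiset.map_cons,
        Multiset.map_singleton, Multiset.sum_cons, Multiset.sum_singleton, Interval.length,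
        Interval.left, Interval.right, ofLex_toLex]
      rw [Fin.lt_def] at hij hjk hkl
      lia
    · rw [xPart_uuMon, xPart_uuMon]
    · simp [uPart_uuMon, Interval.left]
    · have h1 : ∀ {p q : Interval n}, p < q → ({p, q} : Multiset (Interval n)).sort = [p, q] := by
        intro p q h
        rw [Multiset.insert_eq_cons, Multiset.sort_cons, Multiset.sort_singleton]
        simpa using h.le
      rw [uPart_uuMon, uPart_uuMon, h1, h1, List.cons_lt_cons_iff]
      · exact Or.inl ((Interval.lt_iff' _ _).2 (Or.inr ⟨rfl, hkl⟩))
      · exact (Interval.lt_iff' _ _).2 (Or.inl hij)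
      · exact (Interval.lt_iff' _ _).2 (Or.inl hij)
  left_noncrossing := by
    simp only [IsNoncrossing, uPart_uuMon, xPart_uuMon, Multiset.insert_eq_cons,
      Multiset.mem_cons, Multiset.mem_singleton, forall_eq_or_imp, forall_eq, Interval.Intersects,
      Interval.left, Interval.right, ofLex_toLex, Multiset.notMem_zero, Fin.lt_def] at *
    refine ⟨?_, by simp⟩
    lia
  right_noncrossing := by
    simp only [IsNoncrossing, uPart_uuMon, xPart_uuMon, Multiset.insert_eq_cons,
      Multiset.mem_cons, Multiset.mem_singleton, forall_eq_or_imp, forall_eq, Interval.Intersects,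
      Interval.left, Interval.right, ofLex_toLex, Multiset.notMem_zero, Fin.lt_def] at *
    refine ⟨?_, by simp⟩
    lia
  not_noncrossing h := h.1 (interval (hij.trans hjk)) (by simp [uPart_uuMon])
    (interval (hjk.trans hkl)) (by simp [uPart_uuMon]) (Or.inl ⟨hij, hjk, hkl⟩)
  degree_eq := by simp [uuMon]

theorem isRelation_relS {i j k : Fin n} (hij : i < j) (hjk : j < k) :
    IsRelation (xuMon i (interval hjk)) (xuMon j (interval (hij.trans hjk)))
      (xuMon k (interval hij)) where
  left_gt := by
    refine Or.inr (Or.inr (Or.inl ⟨?_, ?_, ?_⟩))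
    · simp [xDeg, xPart_xuMon]
    · simp [uDeg, uPart_xuMon]
    · simp only [totalLength, uPart_xuMon, Multiset.map_singleton, Multiset.sum_singleton,
        Interval.length, Interval.left, Interval.right, ofLex_toLex]
      rw [Fin.lt_def] at hij hjk
      lia
  right_gt := by
    refine Or.inr (Or.inr (Or.inl ⟨?_, ?_, ?_⟩))
    · simp [xDeg, xPart_xuMon]
    · simp [uDeg, uPart_xuMon]
    · simp only [totalLength, uPart_xuMon, Multiset.map_singleton, Multiset.sum_singleton,
        Interval.length, Interval.left, Interval.right, ofLex_toLex]
      rw [Fin.lt_def] at hij hjk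
      lia
  left_noncrossing := by
    simp only [IsNoncrossing, uPart_xuMon, xPart_xuMon, Multiset.mem_singleton, forall_eq,
      Interval.Intersects, Interval.Covers, Interval.left, Interval.right, ofLex_toLex,
      Fin.lt_def] at *
    lia
  right_noncrossing := by
    simp only [IsNoncrossing, uPart_xuMon, xPart_xuMon, Multiset.mem_singleton, forall_eq,
      Interval.Intersects, Interval.Covers, Interval.left, Interval.right, ofLex_toLex,
      Fin.lt_def] at *
    lia
  not_noncrossing h := h.2 (interval (hij.trans hjk)) (by simp [uPart_xuMon])
    j (by simp [xPart_xuMon]) ⟨hij, hjk⟩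
  degree_eq := by simp [xuMon]

variable {K : Type*} [Field K]

/-- The polynomial `a - b + c`. -/
noncomputable def trinomial (K : Type*) [Field K] (a b c : Var n →₀ ℕ) : PolyXU n K :=
  monomial a 1 - monomial b 1 + monomial c 1

theorem trinomial_uuMon_mem {i j k l : Fin n} (hij : i < j) (hjk : j < k) (hkl : k < l) :
    trinomial K (uuMon (interval hij) (interval hkl))
      (uuMon (interval (hij.trans hjk)) (interval (hjk.trans hkl)))
      (uuMon (interval ((hij.trans hjk).trans hkl)) (interval hjk)) ∈ relR n K ∪ relS n K := by
  refine Or.inl ⟨i, j, k, l, hij, hjk, hkl, ?_⟩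
  simp only [u, X, monomial_mul, one_mul]
  rfl

theorem trinomial_xuMon_mem {i j k : Fin n} (hij : i < j) (hjk : j < k) :
    trinomial K (xuMon i (interval hjk)) (xuMon j (interval (hij.trans hjk)))
      (xuMon k (interval hij)) ∈ relR n K ∪ relS n K := by
  refine Or.inr ⟨i, j, k, hij, hjk, ?_⟩
  simp only [u, x, X, monomial_mul, one_mul]
  rfl

theorem exists_isRelation {g : PolyXU n K} (hg : g ∈ relR n K ∪ relS n K) :
    ∃ a b c, IsRelation a b c ∧ g = trinomial K a b c := by
  rcases hg with ⟨i, j, k, l, hij, hjk, hkl, rfl⟩ | ⟨i, j, k, hij, hjk, rfl⟩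
  · refine ⟨_, _, _, isRelation_relR hij hjk hkl, ?_⟩
    simp only [u, X, monomial_mul, one_mul]
    rfl
  · refine ⟨_, _, _, isRelation_relS hij hjk, ?_⟩
    simp only [u, x, X, monomial_mul, one_mul]
    rfl

theorem IsRelation.ne_left {a b c : Var n →₀ ℕ} (h : IsRelation a b c) : a ≠ b :=
  fun hab => h.not_noncrossing (hab ▸ h.left_noncrossing)

theorem IsRelation.ne_right {a b c : Var n →₀ ℕ} (h : IsRelation a b c) : c ≠ b :=
  fun hcb => h.not_noncrossing (hcb ▸ h.right_noncrossing)

theorem IsRelation.coeff_trinomial {a b c : Var n →₀ ℕ} (h : IsRelation a b c) :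
    coeff b (trinomial K a b c) = -1 := by
  simp [trinomial, coeff_monomial, h.ne_left, h.ne_right]

theorem mem_support_trinomial {a b c v : Var n →₀ ℕ} (hv : v ∈ (trinomial K a b c).support) :
    v = a ∨ v = b ∨ v = c := by
  by_contra! h
  simp [trinomial, coeff_monomial, h.1.symm, h.2.1.symm, h.2.2.symm] at hv

theorem IsRelation.degree_trinomial {a b c : Var n →₀ ℕ} (h : IsRelation a b c) :
    (dill n).degree (trinomial K a b c) = b := by
  apply (dill n).toSyn.injective
  apply le_antisymm
  · rw [MonomialOrder.degree_le_iff]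
    intro v hv
    rcases mem_support_trinomial hv with rfl | rfl | rfl
    · exact ((dill_lt_iff _ _).2 h.left_gt).le
    · exact le_rfl
    · exact ((dill_lt_iff _ _).2 h.right_gt).le
  · apply MonomialOrder.le_degree
    rw [mem_support_iff, h.coeff_trinomial]
    exact neg_ne_zero.2 one_ne_zero

/-- An intersecting pair is the leading monomial of an element of `R`, and a covered `x` with its
covering `u` that of an element of `S`. -/
theorem exists_degree_le_of_not_isNoncrossing {v : Var n →₀ ℕ} (hv : ¬ IsNoncrossing v) :
    ∃ g ∈ relR n K ∪ relS n K, (dill n).degree g ≤ v := by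
  have hI : ∀ {p q : Interval n}, p ∈ uPart v → q ∈ uPart v → p.left < q.left →
      q.left < p.right → p.right < q.right →
      ∃ g ∈ relR n K ∪ relS n K, (dill n).degree g ≤ v := by
    intro p q hp hq h1 h2 h3
    refine ⟨_, trinomial_uuMon_mem h1 h2 h3, ?_⟩
    rw [(isRelation_relR h1 h2 h3).degree_trinomial]
    refine single_add_single_le ?_ (mem_uPart.1 hp) (mem_uPart.1 hq)
    intro h
    have := congrArg Interval.left (Sum.inr_injective h)
    exact h1.ne this
  rw [IsNoncrossing, not_and_or] at hv
  push Not at hv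
  rcases hv with ⟨p, hp, q, hq, h | h⟩ | ⟨p, hp, i, hi, h⟩
  · exact hI hp hq h.1 h.2.1 h.2.2
  · exact hI hq hp h.1 h.2.1 h.2.2
  · refine ⟨_, trinomial_xuMon_mem h.1 h.2, ?_⟩
    rw [(isRelation_relS h.1 h.2).degree_trinomial]
    exact single_add_single_le (by simp) (mem_xPart.1 hi) (mem_uPart.1 hp)

/-! ### Division by `R ∪ S` and the kernel of `π` -/

/-- The division algorithm applies because all leading coefficients are `-1`. The bound on the
summands is kept for the Gröbner property. -/
theorem exists_division (f : PolyXU n K) :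
    ∃ (g : ↥(relR n K ∪ relS n K) →₀ PolyXU n K) (r : PolyXU n K),
      f = Finsupp.linearCombination _ (fun b : ↥(relR n K ∪ relS n K) => (b : PolyXU n K)) g + r ∧
      (∀ b : ↥(relR n K ∪ relS n K), (dill n).toSyn ((dill n).degree ((b : PolyXU n K) * g b)) ≤
        (dill n).toSyn ((dill n).degree f)) ∧
      ∀ v ∈ r.support, IsNoncrossing v := by
  obtain ⟨g, r, h1, h2, h3⟩ := (dill n).div_set (B := relR n K ∪ relS n K) (by
    intro b hb
    obtain ⟨a, b, c, h, rfl⟩ := exists_isRelation hb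
    rw [MonomialOrder.leadingCoeff, h.degree_trinomial, h.coeff_trinomial]
    exact isUnit_one.neg) f
  refine ⟨g, r, h1, h2, fun v hv => ?_⟩
  by_contra hnc
  obtain ⟨b, hb, hbv⟩ := exists_degree_le_of_not_isNoncrossing (K := K) hnc
  exact h3 v hv b hb hbv

theorem piHom_eq_zero_of_mem_rel {g : PolyXU n K} (hg : g ∈ relR n K ∪ relS n K) :
    piHom n K g = 0 := by
  rcases hg with ⟨i, j, k, l, hij, hjk, hkl, rfl⟩ | ⟨i, j, k, hij, hjk, rfl⟩
  · simp only [map_add, map_sub, map_mul, u, piHom_X_inr, Interval.left, Interval.right,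
      ofLex_toLex]
    ring
  · simp only [map_add, map_sub, map_mul, x, u, piHom_X_inl, piHom_X_inr, Interval.left,
      Interval.right, ofLex_toLex]
    ring

theorem relIdeal_le_ker (n : ℕ) (K : Type*) [Field K] :
    relIdeal n K ≤ RingHom.ker (piHom n K) :=
  Ideal.span_le.2 fun _ hg => piHom_eq_zero_of_mem_rel hg

theorem linearCombination_mem_relIdeal (g : ↥(relR n K ∪ relS n K) →₀ PolyXU n K) :
    Finsupp.linearCombination (PolyXU n K)
      (fun b : ↥(relR n K ∪ relS n K) => (b : PolyXU n K)) g ∈ relIdeal n K := by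
  rw [Finsupp.linearCombination_apply, Finsupp.sum]
  exact Ideal.sum_mem _ fun b _ => Ideal.mul_mem_left _ _ (Ideal.subset_span b.2)

/-- The remainder of `f` is noncrossing and also killed by `π`, hence zero. -/
theorem exists_eq_linearCombination {f : PolyXU n K} (hf : piHom n K f = 0) :
    ∃ g : ↥(relR n K ∪ relS n K) →₀ PolyXU n K,
      f = Finsupp.linearCombination _ (fun b : ↥(relR n K ∪ relS n K) => (b : PolyXU n K)) g ∧
      ∀ b : ↥(relR n K ∪ relS n K), (dill n).toSyn ((dill n).degree ((b : PolyXU n K) * g b)) ≤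
        (dill n).toSyn ((dill n).degree f) := by
  obtain ⟨g, r, h1, h2, h3⟩ := exists_division f
  have hr : r = 0 := by
    by_contra h0
    refine (piHom_ne_zero_of_noncrossing h0 h3).1 ?_
    have h4 : piHom n K _ = 0 := relIdeal_le_ker n K (linearCombination_mem_relIdeal g)
    rw [h1, map_add, h4, zero_add] at hf
    exact hf
  rw [hr, add_zero] at h1
  exact ⟨g, h1, h2⟩

theorem ker_piHom (n : ℕ) (K : Type*) [Field K] : RingHom.ker (piHom n K) = relIdeal n K := by
  refine le_antisymm (fun f hf => ?_) (relIdeal_le_ker n K)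
  obtain ⟨g, h, -⟩ := exists_eq_linearCombination hf
  rw [h]
  exact linearCombination_mem_relIdeal g

/-! ### The reduced Gröbner basis property -/

theorem isGroebnerBasis_rel (n : ℕ) (K : Type*) [Field K] :
    IsGroebnerBasis (dill n) (relR n K ∪ relS n K) (relIdeal n K) where
  zero_notMem h0 := by
    obtain ⟨a, b, c, h, h1⟩ := exists_isRelation h0
    have := h.coeff_trinomial (K := K)
    rw [← h1, coeff_zero] at this
    exact neg_ne_zero.2 one_ne_zero this.symm
  span_eq := rfl
  exists_degree_le f hf hf0 := by
    obtain ⟨g, h1, h2⟩ := exists_eq_linearCombination (relIdeal_le_ker n K hf)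
    have h3 : coeff ((dill n).degree f) f ≠ 0 := (dill n).coeff_degree_ne_zero_iff.2 hf0
    nth_rw 2 [h1] at h3
    rw [Finsupp.linearCombination_apply, Finsupp.sum, coeff_sum] at h3
    -- Some summand must contribute the leading monomial of `f`. As no summand exceeds it, that
    -- summand has exactly this degree, which the degree of its factor `b` divides.
    obtain ⟨b, -, hb⟩ := Finset.exists_ne_zero_of_sum_ne_zero h3
    rw [smul_eq_mul, mul_comm] at hb
    have h4 : (dill n).degree ((b : PolyXU n K) * g b) = (dill n).degree f :=
      (dill n).toSyn.injective
        (le_antisymm (h2 b) ((dill n).le_degree (mem_support_iff.2 hb)))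
    refine ⟨b, b.2, ?_⟩
    rw [← h4, (dill n).degree_mul' fun h => hb (by rw [h, coeff_zero])]
    exact le_self_add

/-- In `f - g` the common crossing monomial cancels, both coefficients being `-1`. What remains is
noncrossing and lies in the kernel of `π`, so it is zero. -/
theorem eq_of_degree_eq {f g : PolyXU n K} (hf : f ∈ relR n K ∪ relS n K)
    (hg : g ∈ relR n K ∪ relS n K) (h : (dill n).degree f = (dill n).degree g) : f = g := by
  have hpi : piHom n K (f - g) = 0 := by
    rw [map_sub, piHom_eq_zero_of_mem_rel hf, piHom_eq_zero_of_mem_rel hg, sub_zero]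
  by_contra hne
  refine (piHom_ne_zero_of_noncrossing (sub_ne_zero.2 hne) fun v hv => ?_).1 hpi
  obtain ⟨a, b, c, hr, rfl⟩ := exists_isRelation hf
  obtain ⟨a', b', c', hr', rfl⟩ := exists_isRelation hg
  rw [hr.degree_trinomial, hr'.degree_trinomial] at h
  subst h
  have hvb : v ≠ b := by
    rintro rfl
    rw [mem_support_iff, coeff_sub, hr.coeff_trinomial, hr'.coeff_trinomial, sub_self] at hv
    exact hv rfl
  classical
  rcases Finset.mem_union.1 (support_sub _ _ _ hv) with h | h
  · rcases mem_support_trinomial h with rfl | h | rfl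
    · exact hr.left_noncrossing
    · exact absurd h hvb
    · exact hr.right_noncrossing
  · rcases mem_support_trinomial h with rfl | h | rfl
    · exact hr'.left_noncrossing
    · exact absurd h hvb
    · exact hr'.right_noncrossing

theorem isReducedGroebnerBasis_rel (n : ℕ) (K : Type*) [Field K] :
    IsReducedGroebnerBasis (dill n) (relR n K ∪ relS n K) (relIdeal n K) where
  toIsGroebnerBasis := isGroebnerBasis_rel n K
  not_degree_le f hf v hv g hg hle := by
    obtain ⟨a, b, c, hr, hfr⟩ := exists_isRelation hf
    obtain ⟨a', b', c', hr', hgr⟩ := exists_isRelation hg.1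
    have hgd : (dill n).degree g = b' := hgr ▸ hr'.degree_trinomial
    rw [hgd] at hle
    rw [hfr] at hv
    rcases mem_support_trinomial hv with rfl | rfl | rfl
    · exact hr'.not_noncrossing (hr.left_noncrossing.mono hle)
    · refine hg.2 (eq_of_degree_eq hg.1 hf ?_)
      rw [hgd, hfr, hr.degree_trinomial]
      -- Both leading monomials have degree two, so the quotient `e` is trivial.
      obtain ⟨e, rfl⟩ := exists_add_of_le hle
      have h := hr.degree_eq
      rw [map_add, hr'.degree_eq] at h
      rw [(Finsupp.degree_eq_zero_iff e).1 (by lia), add_zero]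
    · exact hr'.not_noncrossing (hr.right_noncrossing.mono hle)

end

/-! ### Constants and the slice `y_1 / x_1` -/

/-- The chain rule, the coefficients being constants of `D`. -/
theorem derivation_aeval {K R : Type*} [Field K] [CommRing R] [Algebra K R]
    (D : Derivation K R R) {A : Subalgebra K R} (hA : ∀ a ∈ A, D a = 0) (y : R)
    (p : Polynomial A) :
    D (Polynomial.aeval y p) = D y * Polynomial.aeval y (Polynomial.derivative p) := by
  induction p using Polynomial.induction_on' with
  | add p q hp hq => simp only [map_add, hp, hq, mul_add]
  | monomial m a =>
    have ha : D (algebraMap A R a) = 0 := hA a a.2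
    rw [Polynomial.aeval_monomial, Polynomial.derivative_monomial, Polynomial.aeval_monomial,
      Derivation.leibniz, ha, Derivation.leibniz_pow, map_mul, map_natCast]
    simp only [smul_eq_mul, nsmul_eq_mul]
    ring

/-- An element with nonzero derivative is transcendental over constants: applying `D` to an
algebraic relation and cancelling `D y` gives the relation `p'`, of lower degree. Characteristic `0`
then turns `p' = 0` into `p` being constant. -/
theorem aeval_eq_zero_of_derivation {K R : Type*} [Field K] [CharZero K] [CommRing R]
    [IsDomain R] [Algebra K R] (D : Derivation K R R) {A : Subalgebra K R}
    (hA : ∀ a ∈ A, D a = 0) {y : R} (hy : D y ≠ 0) (m : ℕ) : ∀ p : Polynomial A,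
    p.natDegree ≤ m → Polynomial.aeval y p = 0 → p = 0 := by
  have : CharZero R := charZero_of_injective_algebraMap (algebraMap K R).injective
  have : CharZero A := charZero_of_injective_algebraMap (algebraMap K A).injective
  induction m with
  | zero =>
    intro p hp h
    rw [Polynomial.eq_C_of_natDegree_le_zero hp] at h ⊢
    rw [Polynomial.aeval_C] at h
    rw [show p.coeff 0 = 0 from Subtype.ext h, map_zero]
  | succ m ih =>
    intro p hp h
    have h1 : Polynomial.derivative p = 0 := by
      refine ih _ ((Polynomial.natDegree_derivative_le p).trans (by lia)) ?_
      have := derivation_aeval D hA y p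
      rw [h, map_zero] at this
      exact (mul_eq_zero.1 this.symm).resolve_left hy
    rw [Polynomial.eq_C_of_natDegree_eq_zero
      (Polynomial.derivative_eq_zero.1 h1)] at h ⊢
    rw [Polynomial.aeval_C] at h
    rw [show p.coeff 0 = 0 from Subtype.ext h, map_zero]

section

variable {n : ℕ} {K : Type*} [Field K]

theorem Delta_apply (f : PolyXY n K) :
    Delta n K f = ∑ i, X (Sum.inl i) * pderiv (Sum.inr i) f := by
  have h := map_sum (Derivation.coeFnAddMonoidHom (R := K) (A := PolyXY n K) (M := PolyXY n K))
    (fun i : Fin n => (X (Sum.inl i) : PolyXY n K) • pderiv (Sum.inr i)) Finset.univ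
  have h' := congrFun h f
  rw [Finset.sum_apply] at h'
  exact h'

theorem Delta_X_inl (i : Fin n) : Delta n K (X (Sum.inl i)) = 0 := by
  simp [Delta_apply, pderiv_X]

theorem Delta_X_inr (i : Fin n) : Delta n K (X (Sum.inr i)) = X (Sum.inl i) := by
  simp [Delta_apply, pderiv_X, Pi.single_apply]

theorem Delta_piHom (f : PolyXU n K) : Delta n K (piHom n K f) = 0 := by
  induction f using MvPolynomial.induction_on with
  | C a => rw [← algebraMap_eq, AlgHom.commutes, Derivation.map_algebraMap]
  | add f g hf hg => rw [map_add, map_add, hf, hg, add_zero]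
  | mul_X f a hf =>
    have ha : Delta n K (piHom n K (X a)) = 0 := by
      rcases a with i | p
      · rw [piHom_X_inl, Delta_X_inl]
      · rw [piHom_X_inr, map_sub, Derivation.leibniz, Derivation.leibniz]
        simp only [Delta_X_inl, Delta_X_inr, smul_eq_mul]
        ring
    rw [map_mul, Derivation.leibniz, hf, ha, smul_zero, smul_zero, add_zero]

theorem X_mul_X_mem_range (i j : Fin n) :
    (X (Sum.inl i) * X (Sum.inr j) - X (Sum.inl j) * X (Sum.inr i) : PolyXY n K) ∈
      (piHom n K).range := by
  rcases lt_trichotomy i j with h | rfl | h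
  · exact ⟨X (Sum.inr ⟨toLex (i, j), h⟩), piHom_X_inr _⟩
  · rw [sub_self]
    exact zero_mem _
  · rw [← neg_sub]
    exact neg_mem ⟨X (Sum.inr ⟨toLex (j, i), h⟩), piHom_X_inr _⟩

/-- Each `y_i` becomes linear in `y_o` over the image after multiplication by `x_o`, since `x_o y_i
= (x_o y_i - x_i y_o) + x_i y_o`. -/
theorem exists_pow_mul_eq_aeval (o : Fin n) (f : PolyXY n K) :
    ∃ (m : ℕ) (p : Polynomial (piHom n K).range),
      X (Sum.inl o) ^ m * f = Polynomial.aeval (X (Sum.inr o)) p := by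
  have hx : ∀ i : Fin n, (X (Sum.inl i) : PolyXY n K) ∈ (piHom n K).range :=
    fun i => ⟨X (Sum.inl i), piHom_X_inl i⟩
  have hC : ∀ (z : PolyXY n K) (hz : z ∈ (piHom n K).range),
      Polynomial.aeval (X (Sum.inr o) : PolyXY n K)
        (Polynomial.C (⟨z, hz⟩ : (piHom n K).range)) = z :=
    fun z hz => Polynomial.aeval_C _ _
  have hmul : ∀ {m m' : ℕ} {f : PolyXY n K} {p : Polynomial (piHom n K).range}, m ≤ m' →
      X (Sum.inl o) ^ m * f = Polynomial.aeval (X (Sum.inr o)) p →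
      ∃ q : Polynomial (piHom n K).range,
        X (Sum.inl o) ^ m' * f = Polynomial.aeval (X (Sum.inr o)) q := by
    intro m m' f p hm h
    refine ⟨Polynomial.C ⟨X (Sum.inl o), hx o⟩ ^ (m' - m) * p, ?_⟩
    rw [map_mul, ← h, map_pow, hC, ← mul_assoc, ← pow_add, Nat.sub_add_cancel hm]
  induction f using MvPolynomial.induction_on with
  | C a =>
    have ha : (C a : PolyXY n K) ∈ (piHom n K).range := (piHom n K).range.algebraMap_mem a
    exact ⟨0, Polynomial.C ⟨C a, ha⟩, by rw [hC, pow_zero, one_mul]⟩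
  | add f g hf hg =>
    obtain ⟨m, p, hp⟩ := hf
    obtain ⟨m', q, hq⟩ := hg
    obtain ⟨p', hp'⟩ := hmul (le_max_left m m') hp
    obtain ⟨q', hq'⟩ := hmul (le_max_right m m') hq
    exact ⟨max m m', p' + q', by rw [mul_add, hp', hq', map_add]⟩
  | mul_X f a hf =>
    obtain ⟨m, p, hp⟩ := hf
    rcases a with i | i
    · exact ⟨m, p * Polynomial.C ⟨X (Sum.inl i), hx i⟩, by rw [← mul_assoc, hp, map_mul, hC]⟩
    · refine ⟨m + 1, p * (Polynomial.C ⟨_, X_mul_X_mem_range o i⟩ +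
        Polynomial.C ⟨X (Sum.inl i), hx i⟩ * Polynomial.X), ?_⟩
      rw [map_mul, ← hp, map_add, map_mul, Polynomial.aeval_X, hC, hC]
      ring

/-- Writing `x_o^m f = p(y_o)` and applying `Δ` gives `0 = x_o p'(y_o)`. Transcendence of `y_o` over
the image forces `p' = 0`, so `p` is a constant polynomial with coefficient in the image. -/
theorem exists_pow_mul_mem_range [CharZero K] (o : Fin n) {f : PolyXY n K}
    (hf : Delta n K f = 0) : ∃ m : ℕ, X (Sum.inl o) ^ m * f ∈ (piHom n K).range := by
  obtain ⟨m, p, hp⟩ := exists_pow_mul_eq_aeval o f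
  have hA : ∀ a ∈ (piHom n K).range, Delta n K a = 0 := by
    rintro _ ⟨a, rfl⟩
    exact Delta_piHom a
  have hy : Delta n K (X (Sum.inr o)) ≠ 0 := by
    rw [Delta_X_inr]
    exact X_ne_zero _
  have : CharZero (piHom n K).range :=
    charZero_of_injective_algebraMap (algebraMap K _).injective
  have h1 : Polynomial.derivative p = 0 := by
    refine aeval_eq_zero_of_derivation (Delta n K) hA hy _ _ le_rfl ?_
    have h := derivation_aeval (Delta n K) hA (X (Sum.inr o)) p
    rw [← hp, Derivation.leibniz, hf, Derivation.leibniz_pow, Delta_X_inl] at h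
    simp only [smul_zero, add_zero] at h
    exact (mul_eq_zero.1 h.symm).resolve_left hy
  refine ⟨m, ?_⟩
  rw [hp, Polynomial.eq_C_of_natDegree_eq_zero
    (Polynomial.derivative_eq_zero.1 h1), Polynomial.aeval_C]
  exact (p.coeff 0).2

end

/-! ### The noncrossing basis of the algebra of constants -/

section

variable {n : ℕ} {K : Type*} [Field K]

theorem exists_degree_eq_lead_of_mem_range {g : PolyXY n K} (hg : g ∈ (piHom n K).range)
    (h0 : g ≠ 0) : ∃ v, IsNoncrossing v ∧ (xyOrder n).degree g = lead v := by
  obtain ⟨f, rfl⟩ := hg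
  obtain ⟨q, r, h1, -, h3⟩ := exists_division f
  have h4 : piHom n K _ = 0 := relIdeal_le_ker n K (linearCombination_mem_relIdeal q)
  have h5 : piHom n K f = piHom n K r := by
    conv_lhs => rw [h1, map_add, h4, zero_add]
  have hr : r ≠ 0 := by
    rintro rfl
    exact h0 (h5.trans (map_zero _))
  obtain ⟨v, hv, h⟩ := (piHom_ne_zero_of_noncrossing hr h3).2
  exact ⟨v, hv, (congrArg _ h5).trans h⟩

/-- The least index is never a right end, so no `u` contributes to the exponent of `x_o`. -/
theorem lead_inl_of_forall_le (v : Var n →₀ ℕ) {o : Fin n} (ho : ∀ i, o ≤ i) :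
    lead v (Sum.inl o) = v (Sum.inl o) := by
  have h : o ∉ (uPart v).map Interval.right := by
    rw [Multiset.mem_map]
    rintro ⟨p, -, rfl⟩
    exact absurd p.2 (not_lt.2 (ho _))
  rw [lead, Finsupp.sumFinsuppAddEquivProdFinsupp_symm_inl, Multiset.toFinsupp_apply,
    Multiset.count_add, Multiset.count_eq_zero_of_notMem h, add_zero, xPart,
    Finsupp.count_toMultiset, Finsupp.fst_sumFinsuppAddEquivProdFinsupp]

/-- For `x_o^m f` in the image, the leading exponent is some `lead v` with `v` noncrossing.
Minimality of `o` makes `x_o^m` divide `v`, and the quotient is again noncrossing, with `lead` equal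
to the leading exponent of `f`. -/
theorem exists_degree_eq_lead [CharZero K] {o : Fin n} (ho : ∀ i, o ≤ i) {f : PolyXY n K}
    (hf : Delta n K f = 0) (h0 : f ≠ 0) :
    ∃ v, IsNoncrossing v ∧ (xyOrder n).degree f = lead v := by
  obtain ⟨m, hm⟩ := exists_pow_mul_mem_range o hf
  have hX : (X (Sum.inl o) ^ m : PolyXY n K) ≠ 0 := pow_ne_zero _ (X_ne_zero _)
  obtain ⟨v, hv, h⟩ := exists_degree_eq_lead_of_mem_range hm (mul_ne_zero hX h0)
  rw [MonomialOrder.degree_mul hX h0, MonomialOrder.degree_pow, MonomialOrder.degree_X] at h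
  have hle : m • Finsupp.single (Sum.inl o) 1 ≤ v := by
    have h1 := DFunLike.congr_fun h (Sum.inl o)
    rw [lead_inl_of_forall_le v ho] at h1
    simp only [Finsupp.add_apply, Finsupp.smul_apply, Finsupp.single_eq_same, smul_eq_mul,
      mul_one] at h1
    rw [Finsupp.smul_single, smul_eq_mul, mul_one, Finsupp.single_le_iff]
    lia
  obtain ⟨w, rfl⟩ := exists_add_of_le hle
  rw [lead_add, lead_nsmul, lead_single_inl] at h
  exact ⟨w, hv.mono le_add_self, add_left_cancel h⟩

/-- Well-founded descent on the leading exponent: a scalar multiple of a noncrossing image cancels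
the leading term of `f`, and the difference is still a constant of `Δ`. -/
theorem mem_span_of_Delta_eq_zero [CharZero K] {o : Fin n} (ho : ∀ i, o ≤ i) (f : PolyXY n K)
    (hf : Delta n K f = 0) : f ∈ Submodule.span K (Set.range
      fun v : {v : Var n →₀ ℕ // IsNoncrossing v} => piHom n K (monomial (v : Var n →₀ ℕ) 1)) := by
  induction hs : (xyOrder n).toSyn ((xyOrder n).degree f) using WellFoundedLT.induction
    generalizing f with
  | ind s ih =>
  by_cases h0 : f = 0
  · rw [h0]
    exact zero_mem _
  obtain ⟨v, hv, hd⟩ := exists_degree_eq_lead ho hf h0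
  obtain ⟨h1, h2⟩ := degree_piHom_monomial (K := K) v
  set g := piHom n K (monomial v 1) with hg
  set c := (xyOrder n).leadingCoeff f / (xyOrder n).leadingCoeff g with hc
  have hmem : c • g ∈ Submodule.span K (Set.range
      fun v : {v : Var n →₀ ℕ // IsNoncrossing v} => piHom n K (monomial (v : Var n →₀ ℕ) 1)) :=
    Submodule.smul_mem _ _ (Submodule.subset_span ⟨⟨v, hv⟩, rfl⟩)
  rw [← sub_add_cancel f (c • g)]
  refine add_mem ?_ hmem
  by_cases h3 : f - c • g = 0
  · rw [h3]
    exact zero_mem _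
  refine ih _ ?_ _ ?_ rfl
  · rw [← hs]
    refine lt_of_le_of_ne ((xyOrder n).degree_sub_le.trans (sup_le le_rfl ?_)) fun h => ?_
    · refine (xyOrder n).degree_smul_le.trans ?_
      rw [h1, hd]
    · apply (xyOrder n).coeff_degree_ne_zero_iff.2 h3
      have h4 : (xyOrder n).leadingCoeff g ≠ 0 := (xyOrder n).leadingCoeff_ne_zero_iff.2 h2
      rw [(xyOrder n).toSyn.injective h, coeff_sub, coeff_smul, smul_eq_mul]
      change (xyOrder n).leadingCoeff f - c * coeff ((xyOrder n).degree f) g = 0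
      rw [hd, ← h1]
      change (xyOrder n).leadingCoeff f - c * (xyOrder n).leadingCoeff g = 0
      rw [hc, div_mul_cancel₀ _ h4, sub_self]
  · rw [map_sub, Derivation.map_smul, hf, hg, Delta_piHom, smul_zero, sub_zero]

/-! ### From `K[X,Y]` to the subalgebra of constants -/

/-- The homomorphism `π`, with values in the algebra of constants. -/
noncomputable def piConstants (n : ℕ) (K : Type*) [Field K] : PolyXU n K →ₐ[K] constants n K :=
  (piHom n K).codRestrict (constants n K) Delta_piHom

theorem coe_piConstants (f : PolyXU n K) : (piConstants n K f : PolyXY n K) = piHom n K f :=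
  rfl

theorem ker_piConstants (n : ℕ) (K : Type*) [Field K] :
    RingHom.ker (piConstants n K) = relIdeal n K := by
  rw [← ker_piHom]
  ext f
  rw [RingHom.mem_ker, RingHom.mem_ker, ← coe_piConstants, ZeroMemClass.coe_eq_zero]

theorem span_piConstants_noncrossing [CharZero K] (hn : 1 ≤ n) :
    Submodule.span K (Set.range fun v : {v : Var n →₀ ℕ // IsNoncrossing v} =>
      piConstants n K (monomial (v : Var n →₀ ℕ) 1)) = ⊤ := by
  rw [eq_top_iff]
  rintro ⟨f, hf⟩ -
  have h := mem_span_of_Delta_eq_zero (o := ⟨0, hn⟩) (fun i => Fin.le_def.2 (Nat.zero_le i)) f hf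
  have hr : (Set.range fun v : {v : Var n →₀ ℕ // IsNoncrossing v} =>
      piHom n K (monomial (v : Var n →₀ ℕ) 1)) = (constants n K).val.toLinearMap ''
      Set.range fun v : {v : Var n →₀ ℕ // IsNoncrossing v} =>
        piConstants n K (monomial (v : Var n →₀ ℕ) 1) := by
    rw [← Set.range_comp]
    rfl
  rw [hr, ← Submodule.map_span] at h
  obtain ⟨g, hg, hgf⟩ := h
  rwa [show g = ⟨f, hf⟩ from Subtype.ext hgf] at hg

theorem linearIndependent_piConstants_noncrossing (n : ℕ) (K : Type*) [Field K] :
    LinearIndependent K fun v : {v : Var n →₀ ℕ // IsNoncrossing v} =>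
      piConstants n K (monomial (v : Var n →₀ ℕ) 1) :=
  LinearIndependent.of_comp (constants n K).val.toLinearMap
    (linearIndependent_piHom_noncrossing n K)

theorem piConstants_surjective [CharZero K] (hn : 1 ≤ n) :
    Function.Surjective (piConstants n K) := by
  have h : (⊤ : Submodule K (constants n K)) ≤ LinearMap.range (piConstants n K).toLinearMap := by
    rw [← span_piConstants_noncrossing hn, Submodule.span_le]
    rintro _ ⟨v, rfl⟩
    exact ⟨monomial (v : Var n →₀ ℕ) 1, rfl⟩
  exact fun f => h (Submodule.mem_top (x := f))

end

end Nowicki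

theorem theorem2 (K : Type*) [Field K] [CharZero K] (n : ℕ) (hn : 1 ≤ n) :
    (∃ φ : (Nowicki.PolyXU n K ⧸ Nowicki.relIdeal n K) ≃ₐ[K] Nowicki.constants n K,
      ∀ f : Nowicki.PolyXU n K,
        (φ (Ideal.Quotient.mk (Nowicki.relIdeal n K) f) : Nowicki.PolyXY n K) =
          Nowicki.piHom n K f) ∧
    Nowicki.IsReducedGroebnerBasis (Nowicki.dill n) (Nowicki.relR n K ∪ Nowicki.relS n K)
      (Nowicki.relIdeal n K) ∧
    (∃ b : Module.Basis {v : Nowicki.Var n →₀ ℕ // Nowicki.IsNoncrossing v} K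
        (Nowicki.constants n K),
      ∀ v, (b v : Nowicki.PolyXY n K) =
        Nowicki.piHom n K (MvPolynomial.monomial (v : Nowicki.Var n →₀ ℕ) 1)) := by
  refine ⟨⟨(Ideal.quotientEquivAlgOfEq K (Nowicki.ker_piConstants n K).symm).trans
    (Ideal.quotientKerAlgEquivOfSurjective (Nowicki.piConstants_surjective hn)), fun f => rfl⟩,
    Nowicki.isReducedGroebnerBasis_rel n K,
    ⟨Module.Basis.mk (Nowicki.linearIndependent_piConstants_noncrossing n K)
      (Nowicki.span_piConstants_noncrossing hn).ge, fun v => ?_⟩⟩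
  rw [Module.Basis.mk_apply, Nowicki.coe_piConstants]
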